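/- Let $p\ne 3$ be a prime, let $m,s\ge 1$, and let $\mathbb F=\mathbb F_{p^m}$. Let $\mathcal R=\mathbb F[u,v]/\langle u^2,v^2,uv-vu\rangle$, and let $\alpha=\alpha_1+\alpha_3v+\alpha_4uv$ with $\alpha_1,\alpha_3,\alpha_4\in\mathbb F\setminus\{0\}$ be a non-cube in $\mathcal R$; it is a unit. Put $\alpha_0=\alpha_1^{p^{m-r_0}}$, where $r_0$ is the remainder of $s$ modulo $m$; then $\alpha_0^{p^s}=\alpha_1$. Put $n=3p^s$ and $\mathcal R_\beta=\mathcal R[x]/\langle x^n-\beta\rangle$ for a unit $\beta$. Identify the words of $\mathcal R^n$ with the elements of $\mathcal R_\beta$ by $(c_0,\dots,c_{n-1})\mapsto\sum_i c_ix^i$, so that the $\beta$-constacyclic codes of length $n$ are the ideals of $\mathcal R_\beta$. For an ideal $\mathcal C$ of $\mathcal R_\alpha$ let $\mathcal A(\mathcal C)=\{a\in\mathcal R_\alpha : ab=0 \text{ for all } b\in \mathcal C\}$, and let $\mathcal C^\perp=\{y\in\mathcal R^n:\sum_i c_iy_i=0\text{ for all }c\in \mathcal C\}$, which is regarded as a subset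 of $\mathcal R_{\alpha^{-1}}$. For an ideal $I$ of $\mathcal R_\alpha$ let $I^*\subseteq\mathcal R_{\alpha^{-1}}$ be the set of the classes of the reciprocal polynomials $f^*(x)=x^{\deg f}f(x^{-1})$ of all $f\in\mathcal R[x]$ whose class in $\mathcal R_\alpha$ lies in $I$ (with $0^*=0$). Write $N=2p^s$ and $w=x^3-\alpha_0\in\mathcal R_\alpha$, and $y=x^3-\alpha_0^{-1}\in\mathcal R_{\alpha^{-1}}$. Whenever $z$ occurs, it is an invertible element $z=\sum_{\kappa=0}^{N-1}(z_{0\kappa}x^2+z_{1\kappa}x+z_{2\kappa})w^\kappa$ of $\mathcal R_\alpha$ with $z_{i\kappa}\in\mathbb F$, and for integers $\ell,t,K$ $$S_K=\sum_{0\le\kappa<K}(z_{2\kappa}x^2+z_{1\kappa}x+z_{0\kappa})(-\alpha_0)^\kappa y^\kappa x^{3\ell-3t-3\kappa-2}\in\mathcal R_{\alpha^{-1}}$$ (an empty sum, that is $0$, if $K\le 0$). Let $\Im$ denote the smallest integer $i\ge 0$ such that $uw^i$ lies in the ideal generated by the first listed generator of $\mathcal C$. Then, in each of the following cases, $\mathcal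 C^\perp=\mathcal A(\mathcal C)^*$, and this is the indicated ideal of $\mathcal R_{\alpha^{-1}}$. **Type B.** If $\mathcal C=\langle uw^\ell\rangle$ with $0\le\ell\le N-1$, then $\mathcal C^\perp=\langle y^{N-\ell},u\rangle$. **Type C.** 1. If $\mathcal C=\langle w^\ell\rangle$ with $1\le\ell\le N-1$, then $\mathcal A(\mathcal C)^*=\langle y^{N-\ell}\rangle$. 2. If $\mathcal C=\langle w^\ell+uw^tz\rangle$ with $0\le t<\ell$ and $1\le\ell\le p^s+\frac t2$, then $\mathcal A(\mathcal C)^*=\langle\chi_1^*\rangle$, where $\chi_1^*=(-\alpha_0)^{N-\ell}y^{N-\ell}-u(-\alpha_0)^{N-2\ell+t}y^{N-2\ell+t}S_{\ell-t}$. 3. If $\mathcal C=\langle w^\ell+uw^tz\rangle$ with $0\le t<\ell$ and $p^s+\frac t2<\ell\le N-1$, then $\mathcal A(\mathcal C)^*=\langle\chi_2^*,\;uy^{N-\ell}\rangle$, where $\chi_2^*=(-\alpha_0)^{\ell-t}y^{\ell-t}-uS_{N-\ell}$. **Type D.** 1. If $\mathcal C=\langle w^\ell,\;uw^\mu\rangle$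 with $0\le\ell\le N-1$ and $0\le\mu<\Im$, then $\mathcal A(\mathcal C)^*=\langle(-\alpha_0)^{N-\mu}y^{N-\mu},\;uy^{N-\ell}\rangle$. 2. If $\mathcal C=\langle w^\ell+uw^tz,\;uw^\mu\rangle$ with $0\le t<\ell\le N-1$ and $0\le\mu<\Im$, then $\mathcal A(\mathcal C)^*=\langle\varphi_2^*,\;uy^{N-\ell}\rangle$, where $\varphi_2^*=(-\alpha_0)^{N-\mu}y^{N-\mu}-u(-\alpha_0)^{N+t-\ell-\mu}y^{N+t-\ell-\mu}S_{\mu-t}$. -/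

import Mathlib

noncomputable section

open Polynomial

namespace Constacyclic

/-! ### Codes over a commutative ring -/

section Codes

variable {A : Type*} [CommRing A]

/-- The ring `A[x] / ⟨x ^ n - a⟩`. -/
abbrev QuotRing (n : ℕ) (a : A) : Type _ := AdjoinRoot (X ^ n - C a : A[X])

/-- The identification of the word `(c₀, …, cₙ₋₁)` with the class of
`c₀ + c₁ x + ⋯ + cₙ₋₁ xⁿ⁻¹` in `A[x] / ⟨x ^ n - a⟩`. -/
def toQuot (n : ℕ) (a : A) : (Fin n → A) →ₗ[A] QuotRing n a where
  toFun c := ∑ i : Fin n, c i • (AdjoinRoot.root (X ^ n - C a : A[X])) ^ (i : ℕ)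
  map_add' c d := by simp [add_smul, Finset.sum_add_distrib]
  map_smul' r c := by simp [mul_smul, Finset.smul_sum]

/-- The linear code of length `n` over `A` that corresponds to an ideal of
`A[x] / ⟨x ^ n - a⟩`. -/
def codeOf (n : ℕ) (a : A) (I : Ideal (QuotRing n a)) : Submodule A (Fin n → A) :=
  (I.restrictScalars A).comap (toQuot n a)

/-- The (Euclidean) dual of a linear code of length `n` over `A`. -/
def dualCode {n : ℕ} (D : Submodule A (Fin n → A)) : Submodule A (Fin n → A) where
  carrier := {y | ∀ c ∈ D, ∑ i, c i * y i = 0}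
  add_mem' hy hz c hc := by simp [mul_add, Finset.sum_add_distrib, hy c hc, hz c hc]
  zero_mem' c _ := by simp
  smul_mem' r y hy c hc := by
    have h : ∑ i, c i * (r • y) i = r * ∑ i, c i * y i := by
      rw [Finset.mul_sum]
      exact Finset.sum_congr rfl fun i _ => by simp only [Pi.smul_apply, smul_eq_mul]; ring
    rw [h, hy c hc, mul_zero]

/-- The annihilator `𝒜(I) = {y | y b = 0 for all b ∈ I}`. -/
abbrev ann {S : Type*} [CommRing S] (I : Ideal S) : Ideal S := Submodule.annihilator I

/-- For an ideal `I` of `A[x] / ⟨x ^ n - a⟩`, the set `I^* = {f^* | f ∈ I}` in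
`A[x] / ⟨x ^ n - a⁻¹⟩`; here `f` runs through all polynomials whose class lies in `I`, and
`f^* = x ^ (deg f) f(x⁻¹)` is the reciprocal polynomial. -/
def reciprocal (n : ℕ) (a : Aˣ) (I : Ideal (QuotRing n (a : A))) :
    Set (QuotRing n ((a⁻¹ : Aˣ) : A)) :=
  {y | ∃ f : A[X], AdjoinRoot.mk (X ^ n - C (a : A)) f ∈ I ∧
    y = AdjoinRoot.mk (X ^ n - C ((a⁻¹ : Aˣ) : A)) f.reverse}

/-- The dual of the `a`-constacyclic code given by the ideal `I` is the `a⁻¹`-constacyclic code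
given by the ideal `J`, and `𝒜(I)^* = J`. -/
def HasDualIdeal (n : ℕ) (a : Aˣ) (I : Ideal (QuotRing n (a : A)))
    (J : Ideal (QuotRing n ((a⁻¹ : Aˣ) : A))) : Prop :=
  dualCode (codeOf n (a : A) I) = codeOf n ((a⁻¹ : Aˣ) : A) J ∧
    reciprocal n a (ann I) = (J : Set (QuotRing n ((a⁻¹ : Aˣ) : A)))

end Codes

/-! ### The ring `F[u, v] / ⟨u², v², uv - vu⟩ = F + uF + vF + uvF` -/

/-- `F[u, v] / ⟨u², v², uv - vu⟩`, as the dual numbers in `u` over the dual numbers in `v`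
over `F`. -/
def BaseRing (F : Type*) : Type _ := DualNumber (DualNumber F)

section Base

variable {F : Type*} [Field F]

instance : CommRing (BaseRing F) := inferInstanceAs (CommRing (DualNumber (DualNumber F)))

/-- A constant from `F`. -/
def cst (b : F) : BaseRing F :=
  (TrivSqZeroExt.inl (TrivSqZeroExt.inl b) : DualNumber (DualNumber F))

variable (F) in
/-- The element `u`. -/
def uu : BaseRing F := (DualNumber.eps : DualNumber (DualNumber F))

variable (F) in
/-- The element `v`. -/
def vv : BaseRing F := (TrivSqZeroExt.inl DualNumber.eps : DualNumber (DualNumber F))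

theorem uu_mul_uu : uu F * uu F = 0 :=
  DualNumber.eps_mul_eps (R := DualNumber F)

theorem vv_mul_vv : vv F * vv F = 0 := by
  have h : (TrivSqZeroExt.inl DualNumber.eps : DualNumber (DualNumber F)) *
      TrivSqZeroExt.inl DualNumber.eps = 0 := by
    rw [← TrivSqZeroExt.inl_mul, DualNumber.eps_mul_eps, TrivSqZeroExt.inl_zero]
  exact h

/-- `1, u, v, uv` form a basis over `F`. -/
theorem existsUnique_coords (r : BaseRing F) : ∃! b : F × F × F × F,
    r = cst b.1 + cst b.2.1 * uu F + cst b.2.2.1 * vv F + cst b.2.2.2 * (uu F * vv F) := by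
  have key : ∀ b : F × F × F × F,
      cst b.1 + cst b.2.1 * uu F + cst b.2.2.1 * vv F + cst b.2.2.2 * (uu F * vv F) =
        (((b.1, b.2.2.1), (b.2.1, b.2.2.2)) : (F × F) × (F × F)) := by
    rintro ⟨a, b, c, d⟩
    have h : ((TrivSqZeroExt.inl (TrivSqZeroExt.inl a) +
        TrivSqZeroExt.inl (TrivSqZeroExt.inl b) * TrivSqZeroExt.inr 1 +
        TrivSqZeroExt.inl (TrivSqZeroExt.inl c) * TrivSqZeroExt.inl (TrivSqZeroExt.inr 1) +
        TrivSqZeroExt.inl (TrivSqZeroExt.inl d) *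
          (TrivSqZeroExt.inr 1 * TrivSqZeroExt.inl (TrivSqZeroExt.inr 1)) :
        DualNumber (DualNumber F))) = (((a, c), (b, d)) : (F × F) × (F × F)) := by
      refine TrivSqZeroExt.ext (TrivSqZeroExt.ext ?_ ?_) (TrivSqZeroExt.ext ?_ ?_) <;>
        simp [-DualNumber.inr_eq_smul_eps] <;> rfl
    exact h
  refine ⟨(r.1.1, r.2.1, r.1.2, r.2.2), (key (r.1.1, r.2.1, r.1.2, r.2.2)).symm, ?_⟩
  rintro b hb
  rw [key] at hb
  subst hb
  rfl

/-- `α₀ = α₁ ^ (p ^ (m - r₀))`, where `r₀` is the remainder of `s` modulo `m`. -/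
def alphaZero (p m s : ℕ) (α₁ : F) : F := α₁ ^ p ^ (m - s % m)

/-! ### Elements of `F[u, v] / ⟨u², v², uv - vu⟩ [x] / ⟨x ^ n - a⟩` -/

variable (n : ℕ) (a : BaseRing F)

/-- The class of `x`. -/
def xq : QuotRing n a := AdjoinRoot.root _

/-- The class of `u`. -/
def uq : QuotRing n a := AdjoinRoot.of _ (uu F)

/-- The class of the constant `b ∈ F`. -/
def cq (b : F) : QuotRing n a := AdjoinRoot.of _ (cst b)

/-- The class of `x³ - b`. -/
def wq (b : F) : QuotRing n a := xq n a ^ 3 - cq n a b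

/-- The class of `∑_{k < K} (z₀ₖ x² + z₁ₖ x + z₂ₖ) (x³ - b) ^ k`. -/
def zq (b : F) (K : ℕ) (z₀ z₁ z₂ : ℕ → F) : QuotRing n a :=
  ∑ k ∈ Finset.range K,
    (cq n a (z₀ k) * xq n a ^ 2 + cq n a (z₁ k) * xq n a + cq n a (z₂ k)) * wq n a b ^ k

/-- The class of
`∑_{k < K} (z₂ₖ x² + z₁ₖ x + z₀ₖ) (-b) ^ k (x³ - b⁻¹) ^ k x ^ (3 l - 3 t - 3 k - 2)`. -/
def zqRec (b : F) (K l t : ℕ) (z₀ z₁ z₂ : ℕ → F) : QuotRing n a :=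
  ∑ k ∈ Finset.range K,
    (cq n a (z₂ k) * xq n a ^ 2 + cq n a (z₁ k) * xq n a + cq n a (z₀ k)) *
      cq n a ((-b) ^ k) * wq n a b⁻¹ ^ k * xq n a ^ (3 * l - 3 * t - 3 * k - 2)

/-- The smallest `i` such that `u (x³ - b) ^ i ∈ ⟨g⟩`. -/
def torsionIndex (b : F) (g : QuotRing n a) : ℕ :=
  sInf {i : ℕ | uq n a * wq n a b ^ i ∈ Ideal.span {g}}

end Base

end Constacyclic

end

open Constacyclic

open Polynomial

namespace Constacyclic

/-! ### Duals, reciprocals and the substitution of `x⁻¹` for `x`. -/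

section Duality

variable {A : Type*} [CommRing A] {n : ℕ}

/-! The substitution `x ↦ x⁻¹` is a ring isomorphism from the `α`-constacyclic to the
`α⁻¹`-constacyclic quotient, and the constant coefficient of `c(x) y(x⁻¹)` is the Euclidean product
of `c` and `y`. Hence both the dual code and the reciprocal set of the annihilator are the image of
the annihilator (`dualCode_codeOf`, `reciprocal_eq_map`), and only annihilators remain to be
computed.

In the quotient, `x ^ n - α₁ = (α₃ + α₄ u) v` with `α₃ + α₄ u` a unit, so `v` is redundant: the
quotient is `P + u P`, where `P` is `F[x]` modulo `(x ^ n - α₁) ^ 2` (`exists_polyHom_add`,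
`dvd_of_polyHom_add_eq_zero`). By Frobenius that modulus is `w ^ N`, with `w = x ^ 3 - α₀` and `N =
2 p ^ s`. Cancellation in `F[x]` then gives the annihilator of `⟨w ^ l + u w ^ t z, u w ^ k⟩`
whenever `k ≤ l` and `l + k ≤ N + t` (`ann_span_pair`).

Multiplying the generators by powers of the unit `x` puts their images in reciprocal form; the tail
of `z` is absorbed by the second generator (`hasDualIdeal_span_pair`). Every type of code is an
instance for suitable `l`, `t`, `k`. -/

theorem root_pow_eq (n : ℕ) (a : A) :
    (AdjoinRoot.root (X ^ n - C a : A[X])) ^ n = AdjoinRoot.of (X ^ n - C a : A[X]) a := by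
  have h : AdjoinRoot.mk (X ^ n - C a : A[X]) (X ^ n - C a) = 0 := AdjoinRoot.mk_self
  rw [map_sub, map_pow, AdjoinRoot.mk_X, AdjoinRoot.mk_C, sub_eq_zero] at h
  exact h

/-- The inverse of the class of `x` in `A[x] / ⟨x ^ n - a⟩`, for a unit `a` with inverse `b`. -/
noncomputable def rootInv (n : ℕ) (a b : A) : QuotRing n a :=
  AdjoinRoot.of _ b * AdjoinRoot.root _ ^ (n - 1)

theorem root_mul_rootInv (hn : 0 < n) {a b : A} (hab : a * b = 1) :
    AdjoinRoot.root (X ^ n - C a : A[X]) * rootInv n a b = 1 := by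
  have h : AdjoinRoot.root (X ^ n - C a : A[X]) * AdjoinRoot.root (X ^ n - C a : A[X]) ^ (n - 1) =
      AdjoinRoot.of (X ^ n - C a : A[X]) a := by
    rw [← pow_succ', Nat.sub_add_cancel hn, root_pow_eq]
  rw [rootInv, mul_left_comm, h, ← map_mul, mul_comm, hab, map_one]

theorem rootInv_pow (hn : 0 < n) {a b : A} (hab : a * b = 1) {k : ℕ} (hk : k ≤ n) :
    rootInv n a b ^ k = AdjoinRoot.of _ b * AdjoinRoot.root _ ^ (n - k) := by
  have h := root_mul_rootInv hn hab
  have h1 : AdjoinRoot.of (X ^ n - C a : A[X]) b * AdjoinRoot.root (X ^ n - C a : A[X]) ^ n = 1 := by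
    rw [root_pow_eq, ← map_mul, mul_comm, hab, map_one]
  have h2 : (AdjoinRoot.root (X ^ n - C a : A[X]) * rootInv n a b) ^ k = 1 := by
    rw [h, one_pow]
  calc rootInv n a b ^ k
      = rootInv n a b ^ k * (AdjoinRoot.of (X ^ n - C a : A[X]) b *
          AdjoinRoot.root (X ^ n - C a : A[X]) ^ ((n - k) + k)) := by
        rw [Nat.sub_add_cancel hk, h1, mul_one]
    _ = AdjoinRoot.of _ b * AdjoinRoot.root _ ^ (n - k) *
          (AdjoinRoot.root (X ^ n - C a : A[X]) * rootInv n a b) ^ k := by ring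
    _ = _ := by rw [h2, mul_one]

/-- The ring homomorphism `A[x] / ⟨x ^ n - a⟩ → A[x] / ⟨x ^ n - b⟩`, `x ↦ x⁻¹`, for `a b = 1`. -/
noncomputable def invHom (hn : 0 < n) {a b : A} (hab : a * b = 1) :
    QuotRing n a →+* QuotRing n b :=
  AdjoinRoot.lift (AdjoinRoot.of _) (rootInv n b a) (by
    have hba : b * a = 1 := by rw [mul_comm, hab]
    rw [eval₂_sub, eval₂_X_pow, eval₂_C, rootInv_pow hn hba le_rfl]
    simp)

theorem invHom_of (hn : 0 < n) {a b : A} (hab : a * b = 1) (r : A) :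
    invHom hn hab (AdjoinRoot.of _ r) = AdjoinRoot.of _ r :=
  AdjoinRoot.lift_of _

theorem invHom_root (hn : 0 < n) {a b : A} (hab : a * b = 1) :
    invHom hn hab (AdjoinRoot.root _) = rootInv n b a :=
  AdjoinRoot.lift_root _

theorem invHom_rootInv (hn : 0 < n) {a b : A} (hab : a * b = 1) :
    invHom hn hab (rootInv n a b) = AdjoinRoot.root _ := by
  have hba : b * a = 1 := by rw [mul_comm, hab]
  have h1 := congrArg (invHom hn hab) (root_mul_rootInv hn hab)
  rw [map_mul, invHom_root, map_one] at h1
  have h2 := root_mul_rootInv hn hba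
  calc invHom hn hab (rootInv n a b)
      = (AdjoinRoot.root (X ^ n - C b : A[X]) * rootInv n b a) *
          invHom hn hab (rootInv n a b) := by rw [h2, one_mul]
    _ = AdjoinRoot.root (X ^ n - C b : A[X]) *
          (rootInv n b a * invHom hn hab (rootInv n a b)) := by ring
    _ = _ := by rw [h1, mul_one]

theorem invHom_comp (hn : 0 < n) {a b : A} (hab : a * b = 1) (hba : b * a = 1) :
    (invHom hn hba).comp (invHom hn hab) = RingHom.id _ := by
  refine AdjoinRoot.ringHom_ext ?_ ?_
  · ext r
    simp only [RingHom.comp_apply, invHom_of, RingHom.id_apply]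
  · rw [RingHom.comp_apply, invHom_root, invHom_rootInv, RingHom.id_apply]

/-- The ring isomorphism `A[x] / ⟨x ^ n - a⟩ ≃ A[x] / ⟨x ^ n - b⟩`, `x ↦ x⁻¹`, for `a b = 1`. -/
noncomputable def invEquiv (hn : 0 < n) {a b : A} (hab : a * b = 1) :
    QuotRing n a ≃+* QuotRing n b :=
  RingEquiv.ofRingHom (invHom hn hab) (invHom hn (by rw [mul_comm, hab]))
    (invHom_comp hn _ _) (invHom_comp hn _ _)

theorem invEquiv_apply (hn : 0 < n) {a b : A} (hab : a * b = 1) (r : QuotRing n a) :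
    invEquiv hn hab r = invHom hn hab r := rfl

theorem invEquiv_symm_apply (hn : 0 < n) {a b : A} (hab : a * b = 1) (hba : b * a = 1)
    (r : QuotRing n b) : (invEquiv hn hab).symm r = invHom hn hba r := rfl

/-- Links reciprocal polynomials, which are not additive in `f`, to a ring homomorphism: the two
differ by a power of the unit `x`. -/
theorem mk_reverse (hn : 0 < n) {a b : A} (hab : a * b = 1) (f : A[X]) :
    AdjoinRoot.mk (X ^ n - C b : A[X]) f.reverse =
      AdjoinRoot.root (X ^ n - C b : A[X]) ^ f.natDegree *
        invHom hn hab (AdjoinRoot.mk (X ^ n - C a) f) := by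
  have hba : b * a = 1 := by rw [mul_comm, hab]
  have h := root_mul_rootInv hn hba
  let _ : Invertible (rootInv n b a) := ⟨AdjoinRoot.root _, h, by rw [mul_comm, h]⟩
  have h1 := eval₂_reverse_mul_pow (AdjoinRoot.of (X ^ n - C b : A[X])) (rootInv n b a) f
  have h2 : invHom hn hab (AdjoinRoot.mk (X ^ n - C a) f) =
      eval₂ (AdjoinRoot.of _) (rootInv n b a) f := AdjoinRoot.lift_mk _ _
  have h3 : eval₂ (AdjoinRoot.of (X ^ n - C b : A[X])) (AdjoinRoot.root (X ^ n - C b : A[X]))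
      f.reverse = AdjoinRoot.mk (X ^ n - C b : A[X]) f.reverse := by
    rw [← AdjoinRoot.aeval_eq]
    rfl
  rw [h2, ← h1]
  change _ = _ * (eval₂ (AdjoinRoot.of (X ^ n - C b : A[X]))
    (AdjoinRoot.root (X ^ n - C b : A[X])) f.reverse * _)
  rw [h3, mul_left_comm, ← mul_pow, h, one_pow, mul_one]

theorem toQuot_apply (a : A) (c : Fin n → A) :
    toQuot n a c = ∑ i : Fin n, c i • (AdjoinRoot.root (X ^ n - C a : A[X])) ^ (i : ℕ) := rfl

variable [Nontrivial A]

theorem degree_X_pow_sub_C_eq (hn : 0 < n) (a : A) : (X ^ n - C a : A[X]).degree = n :=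
  degree_X_pow_sub_C hn a

theorem exists_mk_eq (hn : 0 < n) (a : A) (r : QuotRing n a) :
    ∃ f : A[X], f.degree < n ∧ AdjoinRoot.mk (X ^ n - C a : A[X]) f = r := by
  obtain ⟨f, rfl⟩ := AdjoinRoot.mk_surjective r
  have hg := monic_X_pow_sub_C a hn.ne'
  refine ⟨f %ₘ (X ^ n - C a), ?_, ?_⟩
  · rw [← degree_X_pow_sub_C_eq hn a]
    exact degree_modByMonic_lt _ hg
  · rw [AdjoinRoot.mk_eq_mk]
    exact ⟨-(f /ₘ (X ^ n - C a)), by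
      rw [modByMonic_eq_sub_mul_div f]; ring⟩

/-- An ideal absorbs the power of `x` from `mk_reverse`; conversely, a representative of degree
exactly `n` makes that power the constant `a⁻¹`. -/
theorem reciprocal_eq_map (hn : 0 < n) (a : Aˣ) (I : Ideal (QuotRing n (a : A))) :
    reciprocal n a I = (I.map (invEquiv hn a.mul_inv) : Set (QuotRing n ((a⁻¹ : Aˣ) : A))) := by
  ext y
  constructor
  · rintro ⟨f, hf, rfl⟩
    rw [mk_reverse hn a.mul_inv]
    exact Ideal.mul_mem_left _ _ (Ideal.mem_map_of_mem (invEquiv hn a.mul_inv) hf)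
  · intro hy
    obtain ⟨r, hr, rfl⟩ := (Ideal.mem_map_of_equiv (invEquiv hn a.mul_inv) y).1 hy
    -- The factor `a` cancels the later `x ^ n = a⁻¹`; adding `X ^ n - a` forces degree `n` without
    -- changing the class.
    obtain ⟨f, hf, hfr⟩ := exists_mk_eq hn (a : A) (AdjoinRoot.of _ (a : A) * r)
    have hdeg : (f - C (a : A)).degree < n :=
      lt_of_le_of_lt (degree_sub_le _ _)
        (max_lt hf (lt_of_le_of_lt degree_C_le (by exact_mod_cast hn)))
    have hnd : (X ^ n + (f - C (a : A))).natDegree = n := by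
      refine natDegree_eq_of_degree_eq_some ?_
      rw [degree_add_eq_left_of_degree_lt (by rwa [degree_X_pow]), degree_X_pow]
    have hmk : AdjoinRoot.mk (X ^ n - C (a : A)) (X ^ n + (f - C (a : A))) =
        AdjoinRoot.of _ (a : A) * r := by
      rw [← hfr, AdjoinRoot.mk_eq_mk]
      exact ⟨1, by ring⟩
    refine ⟨X ^ n + (f - C (a : A)), ?_, ?_⟩
    · rw [hmk]
      exact Ideal.mul_mem_left _ _ hr
    · rw [mk_reverse hn a.mul_inv, hnd, hmk, root_pow_eq, map_mul, invHom_of, ← mul_assoc,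
        ← map_mul, a.inv_mul, map_one, one_mul, invEquiv_apply]

/-- The coefficient of `1` of an element of `A[x] / ⟨x ^ n - a⟩`. -/
noncomputable def constCoeff (hn : 0 < n) (a : A) : QuotRing n a →ₗ[A] A :=
  (lcoeff A 0).comp (AdjoinRoot.modByMonicHom (monic_X_pow_sub_C a hn.ne'))

theorem constCoeff_root_pow (hn : 0 < n) (a : A) {k : ℕ} (hk : k < n) :
    constCoeff hn a (AdjoinRoot.root _ ^ k) = if k = 0 then 1 else 0 := by
  have hg := monic_X_pow_sub_C a hn.ne'
  rw [← AdjoinRoot.mk_X, ← map_pow, constCoeff, LinearMap.comp_apply,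
    AdjoinRoot.modByMonicHom_mk, (modByMonic_eq_self_iff hg).2, lcoeff_apply, coeff_X_pow]
  · simp only [eq_comm]
  · rw [degree_X_pow, degree_X_pow_sub_C_eq hn]
    exact_mod_cast hk

/-- The exponent `i - j` lies strictly between `-n` and `n`; if negative, the product is `b` times a
power of `x` with exponent strictly between `0` and `n`. -/
theorem constCoeff_root_pow_mul_rootInv_pow (hn : 0 < n) {a b : A} (hab : a * b = 1) {i j : ℕ}
    (hi : i < n) (hj : j < n) :
    constCoeff hn a (AdjoinRoot.root _ ^ i * rootInv n a b ^ j) = if i = j then 1 else 0 := by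
  have h := root_mul_rootInv hn hab
  rcases le_or_gt j i with hji | hij
  · have : AdjoinRoot.root (X ^ n - C a : A[X]) ^ i * rootInv n a b ^ j =
        AdjoinRoot.root (X ^ n - C a : A[X]) ^ (i - j) := by
      conv_lhs => rw [← Nat.sub_add_cancel hji]
      rw [pow_add, mul_assoc, ← mul_pow, h, one_pow, mul_one]
    rw [this, constCoeff_root_pow hn a (by omega)]
    congr 1
    simp only [eq_iff_iff]
    omega
  · have : AdjoinRoot.root (X ^ n - C a : A[X]) ^ i * rootInv n a b ^ j =
        b • AdjoinRoot.root (X ^ n - C a : A[X]) ^ (n - (j - i)) := by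
      conv_lhs => rw [← Nat.sub_add_cancel hij.le]
      rw [pow_add, mul_left_comm, ← mul_pow, h, one_pow, mul_one,
        rootInv_pow hn hab (by omega), Algebra.smul_def]
      rfl
    rw [this, map_smul, constCoeff_root_pow hn a (by omega), if_neg (by omega), if_neg (by omega),
      smul_zero]

theorem toQuot_surjective (hn : 0 < n) (a : A) : Function.Surjective (toQuot n a) := by
  intro r
  obtain ⟨f, hf, rfl⟩ := exists_mk_eq hn a r
  refine ⟨fun i => f.coeff i, ?_⟩
  have hnd : f.natDegree < n := by
    by_cases h0 : f = 0
    · simpa [h0] using hn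
    · exact (natDegree_lt_iff_degree_lt h0).2 hf
  conv_rhs => rw [f.as_sum_range' n hnd]
  rw [toQuot_apply, map_sum, Finset.sum_range]
  refine Finset.sum_congr rfl fun i _ => ?_
  rw [← C_mul_X_pow_eq_monomial, map_mul, map_pow, AdjoinRoot.mk_X, AdjoinRoot.mk_C,
    Algebra.smul_def]
  rfl

theorem constCoeff_toQuot_mul_rootInv_pow (hn : 0 < n) {a b : A} (hab : a * b = 1)
    (c : Fin n → A) (j : Fin n) :
    constCoeff hn a (toQuot n a c * rootInv n a b ^ (j : ℕ)) = c j := by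
  rw [toQuot_apply, Finset.sum_mul, map_sum, Finset.sum_eq_single j]
  · rw [smul_mul_assoc, map_smul, constCoeff_root_pow_mul_rootInv_pow hn hab j.2 j.2, if_pos rfl,
      smul_eq_mul, mul_one]
  · intro i _ hij
    rw [smul_mul_assoc, map_smul, constCoeff_root_pow_mul_rootInv_pow hn hab i.2 j.2,
      if_neg (fun h => hij (Fin.ext h)), smul_zero]
  · simp

theorem constCoeff_toQuot_mul_invHom (hn : 0 < n) {a b : A} (hab : a * b = 1) (hba : b * a = 1)
    (c y : Fin n → A) :
    constCoeff hn a (toQuot n a c * invHom hn hba (toQuot n b y)) = ∑ i, c i * y i := by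
  have h : invHom hn hba (toQuot n b y) = ∑ j : Fin n, y j • rootInv n a b ^ (j : ℕ) := by
    rw [toQuot_apply, map_sum]
    refine Finset.sum_congr rfl fun j _ => ?_
    rw [Algebra.smul_def, Algebra.smul_def, map_mul, map_pow, invHom_root]
    exact congrArg (· * _) (invHom_of hn hba (y j))
  rw [h, Finset.mul_sum, map_sum]
  refine Finset.sum_congr rfl fun j _ => ?_
  rw [mul_smul_comm, map_smul, constCoeff_toQuot_mul_rootInv_pow hn hab, smul_eq_mul, mul_comm]

theorem eq_zero_of_constCoeff (hn : 0 < n) {a b : A} (hab : a * b = 1) (r : QuotRing n a)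
    (h : ∀ k : ℕ, constCoeff hn a (r * rootInv n a b ^ k) = 0) : r = 0 := by
  obtain ⟨c, rfl⟩ := toQuot_surjective hn a r
  have hc : c = 0 := by
    ext j
    rw [← constCoeff_toQuot_mul_rootInv_pow hn hab c j, h, Pi.zero_apply]
  rw [hc, map_zero]

/-- Since `I` is closed under multiplication by powers of `x⁻¹`, orthogonality to `I` kills every
coefficient of the product with `y(x⁻¹)`, not just the constant one. -/
theorem dualCode_codeOf (hn : 0 < n) (a : Aˣ) (I : Ideal (QuotRing n (a : A))) :
    dualCode (codeOf n (a : A) I) =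
      codeOf n ((a⁻¹ : Aˣ) : A) ((ann I).map (invEquiv hn a.mul_inv)) := by
  ext y
  have h1 : y ∈ codeOf n ((a⁻¹ : Aˣ) : A) ((ann I).map (invEquiv hn a.mul_inv)) ↔
      invHom hn a.inv_mul (toQuot n _ y) ∈ ann I := by
    change toQuot n _ y ∈ (ann I).map (invEquiv hn a.mul_inv) ↔ _
    rw [Ideal.mem_map_of_equiv]
    constructor
    · rintro ⟨r, hr, hry⟩
      rw [← hry, ← invEquiv_symm_apply hn a.mul_inv, RingEquiv.symm_apply_apply]
      exact hr
    · intro h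
      exact ⟨_, h, by rw [← invEquiv_symm_apply hn a.mul_inv, RingEquiv.apply_symm_apply]⟩
  rw [h1, Submodule.mem_annihilator]
  constructor
  · intro h r hr
    refine eq_zero_of_constCoeff hn a.mul_inv _ fun k => ?_
    obtain ⟨c, hc⟩ := toQuot_surjective hn (a : A) (r * rootInv n (a : A) ((a⁻¹ : Aˣ) : A) ^ k)
    have h2 := h c (show toQuot n (a : A) c ∈ I from hc ▸ Ideal.mul_mem_right _ _ hr)
    rw [← constCoeff_toQuot_mul_invHom hn a.mul_inv a.inv_mul, hc] at h2
    rw [← h2, smul_eq_mul]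
    congr 1
    ring
  · intro h c hc
    rw [← constCoeff_toQuot_mul_invHom hn a.mul_inv a.inv_mul, mul_comm, ← smul_eq_mul,
      h _ hc, map_zero]

theorem hasDualIdeal_of_map_ann_eq (hn : 0 < n) (a : Aˣ) {I : Ideal (QuotRing n (a : A))}
    {J : Ideal (QuotRing n ((a⁻¹ : Aˣ) : A))}
    (h : (ann I).map (invEquiv hn a.mul_inv) = J) : HasDualIdeal n a I J := by
  subst h
  exact ⟨dualCode_codeOf hn a I, reciprocal_eq_map hn a _⟩

end Duality

/-! ### Annihilators in a ring `P + u P` with `u ^ 2 = 0`. -/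

section Annihilator

theorem span_pair_eq_span_pair {R : Type*} [CommRing R] {a b a' b' e f c : R} (he : IsUnit e)
    (hf : IsUnit f) (ha : e * a = a' + c * b') (hb : f * b = b') :
    Ideal.span {a, b} = Ideal.span {a', b'} := by
  have hb' : Ideal.span {b} = Ideal.span {b'} := by
    rw [← hb, Ideal.span_singleton_mul_left_unit hf]
  rw [Ideal.span_insert, Ideal.span_insert, hb', ← Ideal.span_singleton_mul_left_unit he a, ha,
    ← Ideal.span_insert, ← Ideal.span_insert]
  exact Ideal.span_pair_add_mul_right _ _ _

/-- The annihilator of `⟨w ^ l + u w ^ t z, u w ^ k⟩` in a ring `P + u P` with `u ^ 2 = 0`, where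
`P` is the quotient of a domain by the `N`-th power of `W`. -/
theorem ann_span_pair {P R : Type*} [CommRing P] [IsDomain P] [CommRing R] (ψ : P →+* R) {u : R}
    (hu : u * u = 0) {W : P} (hW : W ≠ 0) {N : ℕ}
    (hsurj : ∀ r : R, ∃ a b : P, r = ψ a + u * ψ b)
    (hzero : ∀ a b : P, ψ a + u * ψ b = 0 → W ^ N ∣ a ∧ W ^ N ∣ b) (hWN : ψ W ^ N = 0)
    {l t k : ℕ} (hlN : l ≤ N) (hkl : k ≤ l) (hlk : l + k ≤ N + t) (Z : P) :
    ann (Ideal.span {ψ W ^ l + u * ψ W ^ t * ψ Z, u * ψ W ^ k}) =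
      Ideal.span {ψ W ^ (N - k) - u * ψ W ^ (N + t - l - k) * ψ Z, u * ψ W ^ (N - l)} := by
  -- Write `l = k + c`, `N = k + c + d`, `e = N + t - l - k`, to avoid truncated subtraction.
  obtain ⟨e, he⟩ := Nat.exists_eq_add_of_le hlk
  have hE : N + t - l - k = e := by omega
  obtain ⟨d, rfl⟩ := Nat.exists_eq_add_of_le hlN
  obtain ⟨c, rfl⟩ := Nat.exists_eq_add_of_le hkl
  have h1 : k + c + d - k = c + d := by omega
  have h2 : k + c + d - (k + c) = d := by omega
  rw [hE, h1, h2]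
  have hz : ∀ x, ψ W ^ (k + c + d) * x = 0 := fun x => by rw [hWN, zero_mul]
  have het : c + d + t = k + c + e := by omega
  have het' : W ^ (c + d) * W ^ t = W ^ (k + c) * W ^ e := by rw [← pow_add, ← pow_add, het]
  have hψ : ψ W ^ (c + d) * ψ W ^ t = ψ W ^ (k + c) * ψ W ^ e := by
    simpa only [map_mul, map_pow] using congrArg ψ het'
  apply le_antisymm
  · intro r hr
    obtain ⟨a, b, rfl⟩ := hsurj r
    rw [Submodule.mem_annihilator] at hr
    have r1 : (ψ a + u * ψ b) * (ψ W ^ (k + c) + u * ψ W ^ t * ψ Z) = 0 :=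
      hr _ (Ideal.subset_span (by simp))
    have r2 : (ψ a + u * ψ b) * (u * ψ W ^ k) = 0 := hr _ (Ideal.subset_span (by simp))
    -- Only the `u`-components matter: the second generator gives `W ^ N ∣ a W ^ k`, the first `W ^
    -- N ∣ b W ^ l + a W ^ t Z`. Cancelling powers of `W` in the domain `P` determines `a` and `b`.
    obtain ⟨-, a', ha'⟩ := hzero 0 (a * W ^ k) (by
      simp only [map_zero, map_mul, map_pow]
      linear_combination r2 - ψ b * ψ W ^ k * hu)
    obtain ⟨-, b', hb'⟩ := hzero (a * W ^ (k + c)) (b * W ^ (k + c) + a * W ^ t * Z) (by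
      simp only [map_add, map_mul, map_pow]
      linear_combination r1 - ψ b * ψ W ^ t * ψ Z * hu)
    have ha : a = W ^ (c + d) * a' := by
      refine mul_right_cancel₀ (pow_ne_zero k hW) ?_
      rw [ha']; ring
    have hb : b = W ^ d * b' - W ^ e * Z * a' := by
      refine mul_right_cancel₀ (pow_ne_zero (k + c) hW) ?_
      subst ha
      linear_combination hb' - a' * Z * het'
    rw [Ideal.mem_span_pair]
    refine ⟨ψ a', ψ b', ?_⟩
    rw [ha, hb]
    simp only [map_sub, map_mul, map_pow]
    ring
  · rw [Ideal.span_le]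
    have key : ∀ r : R, r * (ψ W ^ (k + c) + u * ψ W ^ t * ψ Z) = 0 → r * (u * ψ W ^ k) = 0 →
        r ∈ ann (Ideal.span {ψ W ^ (k + c) + u * ψ W ^ t * ψ Z, u * ψ W ^ k}) := by
      intro r hr1 hr2
      rw [Submodule.mem_annihilator]
      intro y hy
      obtain ⟨f, g, rfl⟩ := Ideal.mem_span_pair.1 hy
      rw [smul_eq_mul]
      linear_combination f * hr1 + g * hr2
    rintro r (rfl | rfl)
    · refine key _ ?_ ?_
      · linear_combination hz (ψ W ^ c) + u * ψ Z * hψ - ψ W ^ e * ψ Z ^ 2 * ψ W ^ t * hu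
      · linear_combination hz u - ψ W ^ e * ψ Z * ψ W ^ k * hu
    · refine key _ ?_ ?_
      · linear_combination hz u + ψ W ^ d * ψ W ^ t * ψ Z * hu
      · linear_combination ψ W ^ d * ψ W ^ k * hu

end Annihilator

/-! ### Coordinates over `F`, and polynomials over `F` inside the quotient. -/

section Coordinates

variable {F : Type*} [Field F]

instance : Nontrivial (BaseRing F) :=
  inferInstanceAs (Nontrivial (DualNumber (DualNumber F)))

variable (F) in
/-- The embedding of the field of constants. -/
noncomputable def cstHom : F →+* BaseRing F :=
  (TrivSqZeroExt.inlHom (DualNumber F) (DualNumber F)).comp (TrivSqZeroExt.inlHom F F)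

theorem cstHom_apply (b : F) : cstHom F b = cst b := rfl

theorem coords_eq_zero {b₁ b₂ b₃ b₄ : F}
    (h : cst b₁ + cst b₂ * uu F + cst b₃ * vv F + cst b₄ * (uu F * vv F) = 0) :
    b₁ = 0 ∧ b₂ = 0 ∧ b₃ = 0 ∧ b₄ = 0 := by
  have h0 : (cst 0 : BaseRing F) = 0 := map_zero (cstHom F)
  have := (existsUnique_coords (0 : BaseRing F)).unique (y₁ := (b₁, b₂, b₃, b₄))
    (y₂ := (0, 0, 0, 0)) h.symm (by simp only [h0]; ring)
  simpa only [Prod.mk.injEq] using this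

/-- The evaluation of polynomials over `F` at the class of `x`. -/
noncomputable def polyHom (n : ℕ) (a : BaseRing F) : F[X] →+* QuotRing n a :=
  (AdjoinRoot.mk _).comp (mapRingHom (cstHom F))

variable (n : ℕ) (a : BaseRing F)

theorem polyHom_C (b : F) : polyHom n a (C b) = cq n a b := by
  simp only [polyHom, RingHom.comp_apply, coe_mapRingHom, map_C, cstHom_apply, AdjoinRoot.mk_C]
  rfl

theorem polyHom_X : polyHom n a X = xq n a := by
  simp only [polyHom, RingHom.comp_apply, coe_mapRingHom, map_X, AdjoinRoot.mk_X]
  rfl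

theorem polyHom_wq (b : F) : polyHom n a (X ^ 3 - C b) = wq n a b := by
  rw [map_sub, map_pow, polyHom_X, polyHom_C, wq]

theorem polyHom_zq (b : F) (K : ℕ) (z₀ z₁ z₂ : ℕ → F) :
    polyHom n a (∑ k ∈ Finset.range K,
      (C (z₀ k) * X ^ 2 + C (z₁ k) * X + C (z₂ k)) * (X ^ 3 - C b) ^ k) = zq n a b K z₀ z₁ z₂ := by
  simp only [map_sum, map_mul, map_add, map_pow, polyHom_C, polyHom_X, polyHom_wq, zq]

theorem cq_mul (b c : F) : cq n a (b * c) = cq n a b * cq n a c := by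
  simp only [← polyHom_C, map_mul]

theorem cq_pow (b : F) (k : ℕ) : cq n a (b ^ k) = cq n a b ^ k := by
  simp only [← polyHom_C, map_pow]

theorem cq_zero : cq n a (0 : F) = 0 := by
  rw [← polyHom_C, map_zero, map_zero]

theorem isUnit_cq {b : F} (hb : b ≠ 0) : IsUnit (cq n a b) := by
  rw [← polyHom_C]
  exact (hb.isUnit.map C).map _

theorem uq_mul_uq : uq n a * uq n a = 0 := by
  rw [uq, ← map_mul, uu_mul_uu, map_zero]

end Coordinates

/-! ### Eliminating `v` from the quotient ring. -/

section Structure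

variable {F : Type*} [Field F] {n : ℕ} {a₁ a₃ a₄ : F} {a : BaseRing F}

theorem polyHom_X_pow_sub_C (ha : a = cst a₁ + cst a₃ * vv F + cst a₄ * (uu F * vv F)) :
    polyHom n a (X ^ n - C a₁) =
      AdjoinRoot.of _ (cst a₃ * vv F + cst a₄ * (uu F * vv F)) := by
  have h : xq n a ^ n = AdjoinRoot.of _ a := root_pow_eq n a
  rw [map_sub, map_pow, polyHom_X, polyHom_C, h, cq, ← map_sub, ha]
  congr 1
  ring

theorem polyHom_X_pow_sub_C_sq (ha : a = cst a₁ + cst a₃ * vv F + cst a₄ * (uu F * vv F)) :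
    polyHom n a ((X ^ n - C a₁) ^ 2) = 0 := by
  rw [map_pow, polyHom_X_pow_sub_C ha, ← map_pow]
  rw [show (cst a₃ * vv F + cst a₄ * (uu F * vv F)) ^ 2 = 0 by
    linear_combination (cst a₃ + cst a₄ * uu F) ^ 2 * vv_mul_vv (F := F), map_zero]

/-- With `Q = x ^ n - a₁ = (a₃ + a₄ u) v`, inverting the unit gives `v = a₃⁻¹ Q - a₄ a₃⁻² u Q`,
which explains the witnesses for monomials. -/
theorem exists_polyHom_add (h₃ : a₃ ≠ 0)
    (ha : a = cst a₁ + cst a₃ * vv F + cst a₄ * (uu F * vv F)) (r : QuotRing n a) :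
    ∃ f g : F[X], r = polyHom n a f + uq n a * polyHom n a g := by
  obtain ⟨q, rfl⟩ := AdjoinRoot.mk_surjective r
  induction q using Polynomial.induction_on' with
  | add q₁ q₂ h1 h2 =>
    obtain ⟨f₁, g₁, e₁⟩ := h1
    obtain ⟨f₂, g₂, e₂⟩ := h2
    exact ⟨f₁ + f₂, g₁ + g₂, by rw [map_add, e₁, e₂, map_add, map_add]; ring⟩
  | monomial k r =>
    obtain ⟨⟨b₁, b₂, b₃, b₄⟩, hr, -⟩ := existsUnique_coords r
    simp only at hr
    have hu := uq_mul_uq n a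
    have hQ := polyHom_X_pow_sub_C (n := n) ha
    have h33 : cq n a a₃ * cq n a a₃⁻¹ = 1 := by
      rw [← cq_mul, mul_inv_cancel₀ h₃, ← polyHom_C, map_one, map_one]
    set v := AdjoinRoot.of (X ^ n - C a) (vv F) with hv
    have hQ' : polyHom n a (X ^ n - C a₁) = cq n a a₃ * v + cq n a a₄ * (uq n a * v) := by
      rw [hQ]; simp only [map_add, map_mul]; rfl
    have hm : AdjoinRoot.mk (X ^ n - C a) (monomial k r) =
        (cq n a b₁ + cq n a b₂ * uq n a + cq n a b₃ * v + cq n a b₄ * (uq n a * v)) *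
          xq n a ^ k := by
      rw [← C_mul_X_pow_eq_monomial, map_mul, map_pow, AdjoinRoot.mk_X, AdjoinRoot.mk_C, hr]
      simp only [map_add, map_mul]
      rfl
    refine ⟨(C b₁ + C (b₃ * a₃⁻¹) * (X ^ n - C a₁)) * X ^ k,
      (C b₂ + (C (b₄ * a₃⁻¹) - C (b₃ * a₄ * a₃⁻¹ * a₃⁻¹)) * (X ^ n - C a₁)) * X ^ k, ?_⟩
    rw [hm]
    simp only [map_add, map_mul (polyHom n a), map_sub (polyHom n a) (C _), hQ', map_pow, polyHom_C,
      polyHom_X, cq_mul]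
    linear_combination v * xq n a ^ k * (uq n a * cq n a b₃ * cq n a a₃⁻¹ * cq n a a₄ -
      uq n a * cq n a b₄ - cq n a b₃) * h33 +
      v * xq n a ^ k * cq n a a₃⁻¹ * cq n a a₄ *
        (cq n a b₃ * cq n a a₃⁻¹ * cq n a a₄ - cq n a b₄) * hu

/-- Take two `Q`-adic digits of `f` and `g`. As `Q` becomes `a₃ v + a₄ u v`, the element has a
representative of degree below `n`, which must vanish; independence of `1, u, v, uv` then kills all
four digits. -/
theorem dvd_of_polyHom_add_eq_zero (hn : 0 < n) (h₃ : a₃ ≠ 0)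
    (ha : a = cst a₁ + cst a₃ * vv F + cst a₄ * (uu F * vv F)) {f g : F[X]}
    (h : polyHom n a f + uq n a * polyHom n a g = 0) :
    (X ^ n - C a₁) ^ 2 ∣ f ∧ (X ^ n - C a₁) ^ 2 ∣ g := by
  set Q : F[X] := X ^ n - C a₁ with hQdef
  have hQm : Q.Monic := monic_X_pow_sub_C a₁ hn.ne'
  have hdecomp : ∀ f : F[X], ∃ f₀ f₁ f₂ : F[X], f = f₀ + Q * f₁ + Q ^ 2 * f₂ ∧
      f₀.degree < n ∧ f₁.degree < n := by
    intro f
    have hd : Q.degree = n := degree_X_pow_sub_C hn a₁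
    refine ⟨f %ₘ Q, (f /ₘ Q) %ₘ Q, (f /ₘ Q) /ₘ Q, ?_, hd ▸ degree_modByMonic_lt _ hQm,
      hd ▸ degree_modByMonic_lt _ hQm⟩
    have e1 := modByMonic_add_div f Q
    have e2 := modByMonic_add_div (f /ₘ Q) Q
    linear_combination -e1 - Q * e2
  obtain ⟨f₀, f₁, f₂, hf, hf₀, hf₁⟩ := hdecomp f
  obtain ⟨g₀, g₁, g₂, hg, hg₀, hg₁⟩ := hdecomp g
  have hQ : polyHom n a Q = _ := polyHom_X_pow_sub_C (n := n) ha
  have hQ2 : polyHom n a Q ^ 2 = 0 := by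
    rw [← map_pow, polyHom_X_pow_sub_C_sq ha]
  set q : (BaseRing F)[X] := f₀.map (cstHom F) + C (uu F) * g₀.map (cstHom F) +
    C (cst a₃ * vv F + cst a₄ * (uu F * vv F)) * f₁.map (cstHom F) +
    C (cst a₃ * (uu F * vv F)) * g₁.map (cstHom F) with hq
  have hqd : q.degree < n := by
    have key : ∀ (r : BaseRing F) (k : F[X]), k.degree < n →
        (C r * k.map (cstHom F)).degree < n := fun r k hk => by
      rw [← smul_eq_C_mul]
      exact lt_of_le_of_lt ((degree_smul_le _ _).trans degree_map_le) hk
    refine lt_of_le_of_lt (degree_add_le _ _) (max_lt ?_ (key _ _ hg₁))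
    refine lt_of_le_of_lt (degree_add_le _ _) (max_lt ?_ (key _ _ hf₁))
    exact lt_of_le_of_lt (degree_add_le _ _)
      (max_lt (lt_of_le_of_lt degree_map_le hf₀) (key _ _ hg₀))
  have hmk : AdjoinRoot.mk (X ^ n - C a) q = 0 := by
    rw [← h, hf, hg]
    simp only [map_add, map_mul, map_pow, hQ2, hq, AdjoinRoot.mk_C]
    rw [hQ]
    have huu : AdjoinRoot.of (X ^ n - C a) (uu F) * AdjoinRoot.of (X ^ n - C a) (uu F) = 0 :=
      uq_mul_uq n a
    simp only [polyHom, RingHom.comp_apply, coe_mapRingHom, uq, map_add, map_mul]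
    linear_combination -(AdjoinRoot.of (X ^ n - C a) (cst a₄) * AdjoinRoot.of (X ^ n - C a) (vv F) *
      AdjoinRoot.mk (X ^ n - C a) (g₁.map (cstHom F))) * huu
  have hq0 : q = 0 := by
    by_contra hne
    refine AdjoinRoot.mk_ne_zero_of_degree_lt (monic_X_pow_sub_C a hn.ne') hne ?_ hmk
    rwa [degree_X_pow_sub_C hn]
  have hc : ∀ i, f₀.coeff i = 0 ∧ g₀.coeff i = 0 ∧ f₁.coeff i = 0 ∧ g₁.coeff i = 0 := by
    intro i
    have hi : q.coeff i = 0 := by rw [hq0, coeff_zero]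
    simp only [hq, coeff_add, coeff_C_mul, coeff_map] at hi
    obtain ⟨e1, e2, e3, e4⟩ := coords_eq_zero (b₁ := f₀.coeff i) (b₂ := g₀.coeff i)
      (b₃ := a₃ * f₁.coeff i) (b₄ := a₄ * f₁.coeff i + a₃ * g₁.coeff i) (by
        simp only [← cstHom_apply, map_add, map_mul] at hi ⊢
        linear_combination hi)
    have e5 : f₁.coeff i = 0 := (mul_eq_zero.1 e3).resolve_left h₃
    rw [e5, mul_zero, zero_add] at e4
    exact ⟨e1, e2, e5, (mul_eq_zero.1 e4).resolve_left h₃⟩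
  have c1 : f₀ = 0 := by ext i; simpa using (hc i).1
  have c2 : g₀ = 0 := by ext i; simpa using (hc i).2.1
  have c3 : f₁ = 0 := by ext i; simpa using (hc i).2.2.1
  have c4 : g₁ = 0 := by ext i; simpa using (hc i).2.2.2
  exact ⟨⟨f₂, by rw [hf, c1, c3]; ring⟩, ⟨g₂, by rw [hg, c2, c4]; ring⟩⟩

end Structure

/-! ### Images of `w` and `z` under `x ↦ x⁻¹`. -/

section Reciprocal

variable {F : Type*} [Field F] {n : ℕ}

theorem zq_add (a : BaseRing F) (b : F) (K L : ℕ) (z₀ z₁ z₂ : ℕ → F) :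
    ∃ r, zq n a b (K + L) z₀ z₁ z₂ = zq n a b K z₀ z₁ z₂ + wq n a b ^ K * r := by
  refine ⟨zq n a b L (fun k => z₀ (K + k)) (fun k => z₁ (K + k)) (fun k => z₂ (K + k)), ?_⟩
  rw [zq, zq, zq, Finset.sum_range_add, Finset.mul_sum]
  congr 1
  exact Finset.sum_congr rfl fun k _ => by rw [pow_add]; ring

theorem isUnit_xq (hn : 0 < n) {a b : BaseRing F} (hab : a * b = 1) : IsUnit (xq n a) :=
  .of_mul_eq_one _ (root_mul_rootInv hn hab)

variable (hn : 0 < n) {a b : BaseRing F} (hab : a * b = 1)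

theorem invHom_cq (c : F) : invHom hn hab (cq n a c) = cq n b c := invHom_of hn hab _

theorem invHom_uq : invHom hn hab (uq n a) = uq n b := invHom_of hn hab _

theorem xq_mul_invHom_xq : xq n b * invHom hn hab (xq n a) = 1 := by
  rw [xq, xq, invHom_root]
  exact root_mul_rootInv hn (by rw [mul_comm, hab])

/-- This is `x³ (x⁻³ - c) = 1 - c x³ = -c (x³ - c⁻¹)`. -/
theorem xq_pow_mul_invHom_wq {c : F} (hc : c ≠ 0) :
    xq n b ^ 3 * invHom hn hab (wq n a c) = cq n b (-c) * wq n b c⁻¹ := by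
  have h : (xq n b * invHom hn hab (xq n a)) ^ 3 = 1 := by
    rw [xq_mul_invHom_xq, one_pow]
  have hcc : cq n b c * cq n b c⁻¹ = 1 := by
    rw [← cq_mul, mul_inv_cancel₀ hc, ← polyHom_C, map_one, map_one]
  have hneg : cq n b (-c) = -cq n b c := by
    simp only [← polyHom_C, map_neg]
  rw [wq, wq, map_sub, map_pow, invHom_cq, hneg]
  linear_combination h - hcc

theorem xq_pow_mul_invHom_wq_pow {c : F} (hc : c ≠ 0) (k : ℕ) :
    xq n b ^ (3 * k) * invHom hn hab (wq n a c ^ k) = cq n b ((-c) ^ k) * wq n b c⁻¹ ^ k := by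
  rw [map_pow, pow_mul, ← mul_pow, xq_pow_mul_invHom_wq hn hab hc, mul_pow, cq_pow]

/-- In the `k`-th term, `x ^ (3 k)` clears `w ^ k` and `x ^ 2` reverses the quadratic coefficient.
The bound on `K` keeps the remaining exponent from being truncated. -/
theorem xq_pow_mul_invHom_zq {c : F} (hc : c ≠ 0) {K l t : ℕ} (hK : K ≤ l - t)
    (z₀ z₁ z₂ : ℕ → F) :
    xq n b ^ (3 * (l - t)) * invHom hn hab (zq n a c K z₀ z₁ z₂) =
      zqRec n b c K l t z₀ z₁ z₂ := by
  rw [zq, zqRec, map_sum, Finset.mul_sum]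
  refine Finset.sum_congr rfl fun k hk => ?_
  have hkK := Finset.mem_range.1 hk
  have hx := xq_mul_invHom_xq hn hab
  have hexp : 3 * (l - t) = 3 * k + 2 + (3 * l - 3 * t - 3 * k - 2) := by omega
  rw [map_mul, hexp, pow_add, pow_add]
  simp only [map_add, map_mul, invHom_cq]
  rw [map_pow (invHom hn hab) (xq n a) 2]
  have hw := xq_pow_mul_invHom_wq_pow hn hab hc k
  set e := 3 * l - 3 * t - 3 * k - 2
  set y := invHom hn hab (xq n a)
  have hz : xq n b ^ 2 * (cq n b (z₀ k) * y ^ 2 + cq n b (z₁ k) * y + cq n b (z₂ k)) =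
      cq n b (z₂ k) * xq n b ^ 2 + cq n b (z₁ k) * xq n b + cq n b (z₀ k) := by
    linear_combination (cq n b (z₀ k) * (xq n b * y + 1) + cq n b (z₁ k) * xq n b) * hx
  rw [← hz]
  linear_combination xq n b ^ 2 * (cq n b (z₀ k) * y ^ 2 + cq n b (z₁ k) * y + cq n b (z₂ k)) *
    xq n b ^ e * hw

end Reciprocal

/-! ### The general two-generator dual, and its specialisations. -/

section Main

variable {F : Type*} [Field F] {n N : ℕ} {α₁ α₃ α₄ α₀ : F} {α : (BaseRing F)ˣ}

/-- The dual of the code `⟨w ^ l + u w ^ t z, u w ^ k⟩` when `k ≤ l` and `l + k ≤ N + t`. -/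
theorem hasDualIdeal_span_pair {N' : ℕ} (hN : N = 2 * N') (hn : 0 < n) (h₃ : α₃ ≠ 0) (h₀ : α₀ ≠ 0)
    (hα : (α : BaseRing F) = cst α₁ + cst α₃ * vv F + cst α₄ * (uu F * vv F))
    (hW : (X ^ 3 - C α₀ : F[X]) ^ N' = X ^ n - C α₁)
    {l t k : ℕ} (hlN : l ≤ N) (hkl : k ≤ l) (hlk : l + k ≤ N + t) (htl : t ≤ l)
    (z₀ z₁ z₂ : ℕ → F) :
    HasDualIdeal n α
      (Ideal.span {wq n α α₀ ^ l + uq n α * wq n α α₀ ^ t * zq n α α₀ N z₀ z₁ z₂,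
        uq n α * wq n α α₀ ^ k})
      (Ideal.span {cq n _ ((-α₀) ^ (N - k)) * wq n _ α₀⁻¹ ^ (N - k)
          - uq n _ * cq n _ ((-α₀) ^ (N + t - l - k))
            * wq n _ α₀⁻¹ ^ (N + t - l - k) * zqRec n _ α₀ (k - t) l t z₀ z₁ z₂,
        uq n _ * wq n _ α₀⁻¹ ^ (N - l)}) := by
  have hWN : (X ^ 3 - C α₀ : F[X]) ^ N = (X ^ n - C α₁) ^ 2 := by
    rw [hN, mul_comm, pow_mul, hW]
  apply hasDualIdeal_of_map_ann_eq hn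
  rw [← polyHom_zq, ← polyHom_wq, ann_span_pair (polyHom n (α : BaseRing F)) (uq_mul_uq n _)
    (X_pow_sub_C_ne_zero (by norm_num) α₀) (exists_polyHom_add h₃ hα)
    (fun f g h => by rw [hWN]; exact dvd_of_polyHom_add_eq_zero hn h₃ hα h)
    (by rw [← map_pow, hWN, polyHom_X_pow_sub_C_sq hα]) hlN hkl hlk, polyHom_zq, polyHom_wq,
    Ideal.map_span, Set.image_pair, invEquiv_apply, invEquiv_apply]
  have hab := α.mul_inv
  -- Cut `z` after `k - t` terms: the tail contributes a multiple of `u w ^ (N - l)`, already in the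
  -- ideal.
  obtain ⟨r, hr⟩ := zq_add (n := n) (α : BaseRing F) α₀ (k - t) (N - (k - t)) z₀ z₁ z₂
  rw [Nat.add_sub_cancel' (by omega)] at hr
  have hx := isUnit_xq hn α.inv_mul
  have hunit : ∀ j : ℕ, IsUnit (cq n ((α⁻¹ : (BaseRing F)ˣ) : BaseRing F) ((-α₀) ^ j)) :=
    fun j => isUnit_cq _ _ (pow_ne_zero _ (neg_ne_zero.2 h₀))
  obtain ⟨g, hg⟩ := (hunit (N - l)).exists_left_inv
  have hwl := xq_pow_mul_invHom_wq_pow hn hab h₀ (N - l)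
  have hwk := xq_pow_mul_invHom_wq_pow hn hab h₀ (N - k)
  have hwe := xq_pow_mul_invHom_wq_pow hn hab h₀ (N + t - l - k)
  have hz := xq_pow_mul_invHom_zq hn hab h₀ (K := k - t) (l := l) (t := t) (by omega) z₀ z₁ z₂
  -- Here `d = 0` if `t ≤ k`; otherwise `k - t` truncates to `0` and `d = t - k`.
  obtain ⟨d, hd⟩ : ∃ d, N + t - l - k + (k - t) = N - l + d :=
    Nat.exists_eq_add_of_le (by omega)
  have hexp : 3 * (N - k) = 3 * (N + t - l - k) + 3 * (l - t) := by omega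
  have hexp' : 3 * (N - k) = 3 * (N - l) + 3 * (l - k) := by omega
  have hw : wq n (α : BaseRing F) α₀ ^ (N + t - l - k) * wq n (α : BaseRing F) α₀ ^ (k - t) =
      wq n (α : BaseRing F) α₀ ^ (N - l) * wq n (α : BaseRing F) α₀ ^ d := by
    rw [← pow_add, hd, pow_add]
  -- The powers of `x` clear the inverses, `g` removes the constant `(-α₀) ^ (N - l)`, and `c`
  -- carries the tail of `z`.
  refine span_pair_eq_span_pair (e := xq n _ ^ (3 * (N - k))) (f := g * xq n _ ^ (3 * (N - l)))
    (c := -(cq n _ ((-α₀) ^ (N - l)) * xq n _ ^ (3 * (l - k)) *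
      invHom hn hab (wq n _ α₀ ^ d * r))) (hx.pow _)
    ((IsUnit.of_mul_eq_one _ hg).mul (hx.pow _)) ?_ ?_
  · have hsplit : wq n (α : BaseRing F) α₀ ^ (N - k) -
        uq n (α : BaseRing F) * wq n (α : BaseRing F) α₀ ^ (N + t - l - k) *
          zq n (α : BaseRing F) α₀ N z₀ z₁ z₂ =
        wq n (α : BaseRing F) α₀ ^ (N - k) -
        uq n (α : BaseRing F) * (wq n (α : BaseRing F) α₀ ^ (N + t - l - k) *
          zq n (α : BaseRing F) α₀ (k - t) z₀ z₁ z₂) -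
        uq n (α : BaseRing F) * (wq n (α : BaseRing F) α₀ ^ (N - l) *
          (wq n (α : BaseRing F) α₀ ^ d * r)) := by
      rw [hr]
      linear_combination -uq n (α : BaseRing F) * r * hw
    rw [hsplit, map_sub, map_sub, map_mul _ (uq n _), map_mul _ (uq n _),
      map_mul _ (_ ^ _) (zq _ _ _ _ _ _ _), map_mul _ (_ ^ _) (_ * r), invHom_uq, mul_sub, mul_sub, hwk,
      ← hz]
    have e1 : xq n ((α⁻¹ : (BaseRing F)ˣ) : BaseRing F) ^ (3 * (N - k)) =
        xq n _ ^ (3 * (N + t - l - k)) * xq n _ ^ (3 * (l - t)) := by rw [hexp, pow_add]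
    have e2 : xq n ((α⁻¹ : (BaseRing F)ˣ) : BaseRing F) ^ (3 * (N - k)) =
        xq n _ ^ (3 * (N - l)) * xq n _ ^ (3 * (l - k)) := by rw [hexp', pow_add]
    have s1 : xq n ((α⁻¹ : (BaseRing F)ˣ) : BaseRing F) ^ (3 * (N - k)) *
        (uq n _ * (invHom hn hab (wq n (α : BaseRing F) α₀ ^ (N + t - l - k)) *
          invHom hn hab (zq n (α : BaseRing F) α₀ (k - t) z₀ z₁ z₂))) =
        uq n _ * cq n _ ((-α₀) ^ (N + t - l - k)) * wq n _ α₀⁻¹ ^ (N + t - l - k) *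
          (xq n _ ^ (3 * (l - t)) *
            invHom hn hab (zq n (α : BaseRing F) α₀ (k - t) z₀ z₁ z₂)) := by
      rw [e1]
      linear_combination uq n _ * (xq n _ ^ (3 * (l - t)) *
            invHom hn hab (zq n (α : BaseRing F) α₀ (k - t) z₀ z₁ z₂)) * hwe
    have s2 : xq n ((α⁻¹ : (BaseRing F)ˣ) : BaseRing F) ^ (3 * (N - k)) *
        (uq n _ * (invHom hn hab (wq n (α : BaseRing F) α₀ ^ (N - l)) *
          invHom hn hab (wq n (α : BaseRing F) α₀ ^ d * r))) =
        cq n _ ((-α₀) ^ (N - l)) * xq n _ ^ (3 * (l - k)) *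
          invHom hn hab (wq n _ α₀ ^ d * r) * (uq n _ * wq n _ α₀⁻¹ ^ (N - l)) := by
      rw [e2]
      linear_combination uq n _ * (xq n _ ^ (3 * (l - k)) *
            invHom hn hab (wq n _ α₀ ^ d * r)) * hwl
    rw [s1, s2]
    ring
  · rw [map_mul, invHom_uq]
    linear_combination uq n _ * g * hwl + uq n _ * wq n _ α₀⁻¹ ^ (N - l) * hg

theorem zq_zero (a : BaseRing F) (b : F) (K : ℕ) : zq n a b K 0 0 0 = 0 := by
  simp [zq, cq_zero]

theorem zqRec_zero_length (a : BaseRing F) (b : F) (l t : ℕ) (z₀ z₁ z₂ : ℕ → F) :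
    zqRec n a b 0 l t z₀ z₁ z₂ = 0 := by
  simp [zqRec]

theorem span_insert_of_mul_eq {R : Type*} [CommRing R] {a b c : R} (h : c * a = b) :
    Ideal.span {a, b} = Ideal.span {a} := by
  rw [Set.pair_comm, Ideal.span_insert]
  exact sup_eq_right.2 ((Ideal.span_singleton_le_iff_mem _).2
    (Ideal.mem_span_singleton'.2 ⟨c, h⟩))

theorem span_pair_mul_left_unit {R : Type*} [CommRing R] {a b e : R} (he : IsUnit e) :
    Ideal.span {e * a, b} = Ideal.span {a, b} := by
  rw [Ideal.span_insert, Ideal.span_singleton_mul_left_unit he, ← Ideal.span_insert]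

end Main

end Constacyclic

theorem theorem8p6
    (p m s : ℕ) (hp : p.Prime) (hp3 : p ≠ 3) (hm : 0 < m) (hs : 0 < s)
    {F : Type*} [Field F] [Fintype F] (hF : Fintype.card F = p ^ m)
    (α₁ α₃ α₄ : F) (h₁ : α₁ ≠ 0) (h₃ : α₃ ≠ 0) (h₄ : α₄ ≠ 0)
    (α : (BaseRing F)ˣ)
    (hα : (α : BaseRing F) = cst α₁ + cst α₃ * vv F + cst α₄ * (uu F * vv F))
    (hcube : ¬ ∃ β : BaseRing F, β ^ 3 = (α : BaseRing F))
    (α₀ : F) (hα₀ : α₀ = alphaZero p m s α₁)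
    (n : ℕ) (hn : n = 3 * p ^ s) :
    -- type B
    (∀ ℓ : ℕ, ℓ ≤ 2 * p ^ s - 1 →
      HasDualIdeal n α
        (Ideal.span {uq n α * wq n α α₀ ^ ℓ})
        (Ideal.span {wq n _ α₀⁻¹ ^ (2 * p ^ s - ℓ), uq n _})) ∧
    -- type C with `z = 0`
    (∀ ℓ : ℕ, 1 ≤ ℓ → ℓ ≤ 2 * p ^ s - 1 →
      HasDualIdeal n α
        (Ideal.span {wq n α α₀ ^ ℓ})
        (Ideal.span {wq n _ α₀⁻¹ ^ (2 * p ^ s - ℓ)})) ∧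
    -- type C with `z` invertible
    (∀ (ℓ t : ℕ) (z₀ z₁ z₂ : ℕ → F), 1 ≤ ℓ → ℓ ≤ 2 * p ^ s - 1 → t < ℓ →
      IsUnit (zq n α α₀ (2 * p ^ s) z₀ z₁ z₂) →
      (2 * ℓ ≤ 2 * p ^ s + t →
        HasDualIdeal n α
          (Ideal.span {wq n α α₀ ^ ℓ
            + uq n α * wq n α α₀ ^ t * zq n α α₀ (2 * p ^ s) z₀ z₁ z₂})
          (Ideal.span {cq n _ ((-α₀) ^ (2 * p ^ s - ℓ)) * wq n _ α₀⁻¹ ^ (2 * p ^ s - ℓ)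
            - uq n _ * cq n _ ((-α₀) ^ (2 * p ^ s + t - 2 * ℓ))
              * wq n _ α₀⁻¹ ^ (2 * p ^ s + t - 2 * ℓ) * zqRec n _ α₀ (ℓ - t) ℓ t z₀ z₁ z₂})) ∧
      (2 * p ^ s + t < 2 * ℓ →
        HasDualIdeal n α
          (Ideal.span {wq n α α₀ ^ ℓ
            + uq n α * wq n α α₀ ^ t * zq n α α₀ (2 * p ^ s) z₀ z₁ z₂})
          (Ideal.span {cq n _ ((-α₀) ^ (ℓ - t)) * wq n _ α₀⁻¹ ^ (ℓ - t)
              - uq n _ * zqRec n _ α₀ (2 * p ^ s - ℓ) ℓ t z₀ z₁ z₂,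
            uq n _ * wq n _ α₀⁻¹ ^ (2 * p ^ s - ℓ)}))) ∧
    -- type D with `z = 0`
    (∀ ℓ μ : ℕ, ℓ ≤ 2 * p ^ s - 1 →
      μ < torsionIndex n α α₀ (wq n α α₀ ^ ℓ) →
      HasDualIdeal n α
        (Ideal.span {wq n α α₀ ^ ℓ, uq n α * wq n α α₀ ^ μ})
        (Ideal.span {cq n _ ((-α₀) ^ (2 * p ^ s - μ)) * wq n _ α₀⁻¹ ^ (2 * p ^ s - μ),
          uq n _ * wq n _ α₀⁻¹ ^ (2 * p ^ s - ℓ)})) ∧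
    -- type D with `z` invertible
    (∀ (ℓ t μ : ℕ) (z₀ z₁ z₂ : ℕ → F), ℓ ≤ 2 * p ^ s - 1 → t < ℓ →
      IsUnit (zq n α α₀ (2 * p ^ s) z₀ z₁ z₂) →
      μ < torsionIndex n α α₀ (wq n α α₀ ^ ℓ
        + uq n α * wq n α α₀ ^ t * zq n α α₀ (2 * p ^ s) z₀ z₁ z₂) →
      HasDualIdeal n α
        (Ideal.span {wq n α α₀ ^ ℓ
            + uq n α * wq n α α₀ ^ t * zq n α α₀ (2 * p ^ s) z₀ z₁ z₂,
          uq n α * wq n α α₀ ^ μ})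
        (Ideal.span {cq n _ ((-α₀) ^ (2 * p ^ s - μ)) * wq n _ α₀⁻¹ ^ (2 * p ^ s - μ)
            - uq n _ * cq n _ ((-α₀) ^ (2 * p ^ s + t - ℓ - μ))
              * wq n _ α₀⁻¹ ^ (2 * p ^ s + t - ℓ - μ) * zqRec n _ α₀ (μ - t) ℓ t z₀ z₁ z₂,
          uq n _ * wq n _ α₀⁻¹ ^ (2 * p ^ s - ℓ)})) := by
  have hpF : CharP F p := by
    have : Fact p.Prime := ⟨hp⟩
    obtain ⟨q, hq⟩ := CharP.exists F
    have hq0 : q ∣ p ^ m := by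
      rw [← CharP.cast_eq_zero_iff F q, ← hF, FiniteField.cast_card_eq_zero]
    have hqp : q.Prime := CharP.char_is_prime F q
    exact (Nat.prime_dvd_prime_iff_eq hqp hp).1 (hqp.dvd_of_dvd_pow hq0) ▸ hq
  -- The total exponent of `p` is a multiple of `m`, and `b ↦ b ^ (p ^ m)` is the identity on `F`.
  have hpow : α₀ ^ p ^ s = α₁ := by
    have hle := (Nat.mod_lt s hm).le
    have hexp : m - s % m + s = m * (1 + s / m) := by
      have := Nat.mod_add_div s m
      rw [mul_add, mul_one]
      omega
    rw [hα₀, alphaZero, ← pow_mul, ← pow_add, hexp, pow_mul, ← hF, FiniteField.pow_card_pow]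
  have h₀ : α₀ ≠ 0 := by
    rintro rfl
    exact h₁ (by rw [← hpow, zero_pow (pow_ne_zero s hp.ne_zero)])
  have hW : (X ^ 3 - C α₀ : F[X]) ^ p ^ s = X ^ n - C α₁ := by
    have : Fact p.Prime := ⟨hp⟩
    rw [sub_pow_char_pow, ← pow_mul, ← hn, ← C_pow, hpow]
  have hps : 0 < p ^ s := pow_pos hp.pos s
  have hn0 : 0 < n := by omega
  clear hn hα₀ hcube hF hpow hpF
  generalize hq : p ^ s = q at *
  have hwN : wq n (α : BaseRing F) α₀ ^ (2 * q) = 0 := by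
    rw [← polyHom_wq, ← map_pow, mul_comm, pow_mul, hW, polyHom_X_pow_sub_C_sq hα]
  have main := @hasDualIdeal_span_pair F _ n (2 * q) α₁ α₃ α₄ α₀ α q rfl hn0 h₃ h₀ hα hW
  have huu := uq_mul_uq n (α : BaseRing F)
  have huu' := uq_mul_uq n ((α⁻¹ : (BaseRing F)ˣ) : BaseRing F)
  have hunit : ∀ j : ℕ, IsUnit (cq n ((α⁻¹ : (BaseRing F)ˣ) : BaseRing F) ((-α₀) ^ j)) :=
    fun j => isUnit_cq _ _ (pow_ne_zero _ (neg_ne_zero.2 h₀))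
  have hone : cq n ((α⁻¹ : (BaseRing F)ˣ) : BaseRing F) 1 = 1 := by
    rw [← polyHom_C, map_one, map_one]
  refine ⟨fun ℓ hℓ => ?_, fun ℓ hℓ1 hℓ => ?_, fun ℓ t z₀ z₁ z₂ hℓ1 hℓ ht hz => ⟨fun h => ?_,
    fun h => ?_⟩, fun ℓ μ hℓ hμ => ?_, fun ℓ t μ z₀ z₁ z₂ hℓ ht hz hμ => ?_⟩
  -- Taking `l = N` makes the first generator `w ^ N = 0`.
  · have := main (l := 2 * q) (t := 2 * q) (k := ℓ) le_rfl (by omega) (by omega) le_rfl 0 0 0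
    rwa [zq_zero, mul_zero, add_zero, hwN, Ideal.span_insert_zero,
      Nat.sub_eq_zero_of_le (by omega : ℓ ≤ 2 * q), zqRec_zero_length, mul_zero, sub_zero,
      span_pair_mul_left_unit (hunit _), Nat.sub_self, pow_zero, mul_one] at this
  · have := main (l := ℓ) (t := ℓ) (k := ℓ) (by omega) le_rfl (by omega) le_rfl 0 0 0
    rwa [zq_zero, mul_zero, add_zero, Nat.sub_self, zqRec_zero_length, mul_zero, sub_zero,
      span_pair_mul_left_unit (hunit _), span_insert_of_mul_eq rfl,
      span_insert_of_mul_eq rfl] at this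
  -- With `k = ℓ` both second generators are redundant: each is, up to a unit, `u` times the first.
  · have := main (l := ℓ) (t := t) (k := ℓ) (by omega) le_rfl (by omega) ht.le z₀ z₁ z₂
    obtain ⟨g, hg⟩ := (hunit (2 * q - ℓ)).exists_left_inv
    rwa [span_insert_of_mul_eq (c := uq n _)
        (by linear_combination wq n (α : BaseRing F) α₀ ^ t *
          zq n (α : BaseRing F) α₀ (2 * q) z₀ z₁ z₂ * huu),
      (by omega : 2 * q + t - ℓ - ℓ = 2 * q + t - 2 * ℓ),
      span_insert_of_mul_eq (c := g * uq n _)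
        (by linear_combination uq n _ * wq n _ α₀⁻¹ ^ (2 * q - ℓ) * hg -
          g * cq n _ ((-α₀) ^ (2 * q + t - 2 * ℓ)) * wq n _ α₀⁻¹ ^ (2 * q + t - 2 * ℓ) *
            zqRec n _ α₀ (ℓ - t) ℓ t z₀ z₁ z₂ * huu')] at this
  -- Multiplying the generator by `z⁻¹ w ^ (N - ℓ)` yields `u w ^ (N + t - ℓ)`, so this `k` adds
  -- nothing to the code.
  · have := main (l := ℓ) (t := t) (k := 2 * q + t - ℓ) (by omega) (by omega) (by omega) ht.le
      z₀ z₁ z₂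
    obtain ⟨g, hg⟩ := hz.exists_left_inv
    have hw : wq n (α : BaseRing F) α₀ ^ (2 * q - ℓ) * wq n (α : BaseRing F) α₀ ^ ℓ = 0 := by
      rw [← pow_add, Nat.sub_add_cancel (by omega), hwN]
    have hw' : wq n (α : BaseRing F) α₀ ^ (2 * q - ℓ) * wq n (α : BaseRing F) α₀ ^ t =
        wq n (α : BaseRing F) α₀ ^ (2 * q + t - ℓ) := by
      rw [← pow_add]
      congr 1
      omega
    rwa [span_insert_of_mul_eq (c := g * wq n _ α₀ ^ (2 * q - ℓ))
        (by linear_combination g * hw + uq n _ * wq n _ α₀ ^ (2 * q + t - ℓ) * hg +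
          g * uq n _ * zq n (α : BaseRing F) α₀ (2 * q) z₀ z₁ z₂ * hw'),
      (by omega : 2 * q + t - ℓ - (2 * q + t - ℓ) = 0),
      (by omega : 2 * q - (2 * q + t - ℓ) = ℓ - t),
      (by omega : 2 * q + t - ℓ - t = 2 * q - ℓ), pow_zero, pow_zero, hone, mul_one,
      mul_one] at this
  · have hμℓ : μ < ℓ := hμ.trans_le (Nat.sInf_le (Ideal.mem_span_singleton'.2 ⟨uq n _, rfl⟩))
    have := main (l := ℓ) (t := ℓ) (k := μ) (by omega) hμℓ.le (by omega) le_rfl 0 0 0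
    rwa [zq_zero, mul_zero, add_zero, Nat.sub_eq_zero_of_le hμℓ.le, zqRec_zero_length, mul_zero,
      sub_zero] at this
  · have hμℓ : μ < ℓ := hμ.trans_le (Nat.sInf_le (Ideal.mem_span_singleton'.2 ⟨uq n _, by
      linear_combination wq n (α : BaseRing F) α₀ ^ t *
        zq n (α : BaseRing F) α₀ (2 * q) z₀ z₁ z₂ * huu⟩))
    obtain ⟨g, hg⟩ := hz.exists_left_inv
    have hw : wq n (α : BaseRing F) α₀ ^ (2 * q - ℓ) * wq n (α : BaseRing F) α₀ ^ ℓ = 0 := by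
      rw [← pow_add, Nat.sub_add_cancel (by omega), hwN]
    -- Both `u w ^ ℓ` and `u w ^ (N - ℓ + t)` lie in the ideal of the first generator, so minimality
    -- of the torsion index supplies the two bounds that `main` needs.
    have hμt : μ < 2 * q - ℓ + t := hμ.trans_le (Nat.sInf_le (Ideal.mem_span_singleton'.2
      ⟨g * wq n _ α₀ ^ (2 * q - ℓ), by
        rw [pow_add]
        linear_combination g * hw + uq n _ * wq n _ α₀ ^ (2 * q - ℓ) * wq n _ α₀ ^ t * hg⟩))
    have := main (l := ℓ) (t := t) (k := μ) (by omega) hμℓ.le (by omega) ht.le z₀ z₁ z₂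
    exact this
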